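/- Let $F_{13}$ be the cubic graph with the twelve vertices $A,B,C,1,2,\dots,9$ and the eighteen edges $12,23,34,45,56,67,78,89,91$ and $A1,A4,A7,B2,B5,B8,C3,C6,C9$. For a simple graph $G$, let $G\cup e$ denote any multigraph obtained from $G$ by adding an edge $e$ in one of the following three ways: (i) subdivide an edge of $G$ once by a new vertex $u$, and add a new vertex $v$, the edge $uv$ and a loop at $v$; (ii) subdivide an edge of $G$ twice by new vertices $u$ and $v$, and add a further edge $uv$, parallel to the one created by the subdivision; (iii) subdivide two distinct edges $e_1,e_2$ of $G$ once each, by new vertices $u$ and $v$ respectively, and add the edge $uv$; this choice of $e$ is written $e_1-e_2$. Then $F_{13}\cup e$ is toroidal, that is, it embeds into the torus, for all choices of $e$. Moreover, up to the symmetries of $F_{13}$ there are exactly ten choices of $e$ such that $F_{13}\cup e$ has girth at least four (where a loop is a cycle of length one and a pair of parallel edges is a cycle of length two): each of the ten choices $A1-B2$, $A1-C3$, $A1-B5$, $A1-23$, $A1-34$, $A1-45$, $A1-56$, $12-34$, $12-45$, $12-56$ gives a graph of girth at least four, and for every choice of $e$ with $F_{13}\cup e$ of girth at least four, exactly one of these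 ten choices $e_1-e_2$ is such that some automorphism of $F_{13}$ maps the set of edges to which $e$ is attached onto $\{e_1,e_2\}$. -/

import Mathlib

namespace ToroidalGraphs

open Graph

/-! ### Embeddings of multigraphs into surfaces -/

/-- An embedding of a multigraph `G` into a topological space `X`: distinct vertices go to distinct
points, every edge goes to a continuous curve joining the images of its ends, which is simple
(apart from the ends, which coincide exactly for a loop), and the curves meet each other and the
images of the vertices only at images of common ends. -/
structure Embedding {α β : Type*} (G : Graph α β) (X : Type*) [TopologicalSpace X] where
  vert : α → X
  arc : β → C(unitInterval, X)
  vert_injOn : Set.InjOn vert V(G)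
  arc_ends : ∀ e x y, G.IsLink e x y →
    (arc e 0 = vert x ∧ arc e 1 = vert y) ∨ (arc e 0 = vert y ∧ arc e 1 = vert x)
  arc_injOn : ∀ e ∈ E(G), Set.InjOn (arc e) (Set.Ioo 0 1)
  arc_ne_vert : ∀ e ∈ E(G), ∀ t ∈ Set.Ioo (0 : unitInterval) 1, ∀ x ∈ V(G), arc e t ≠ vert x
  arc_ne_arc : ∀ e ∈ E(G), ∀ f ∈ E(G), e ≠ f →
    ∀ s ∈ Set.Ioo (0 : unitInterval) 1, ∀ t ∈ Set.Ioo (0 : unitInterval) 1, arc e s ≠ arc f t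

/-- The torus `ℝ/ℤ × ℝ/ℤ`. -/
abbrev Torus : Type := UnitAddCircle × UnitAddCircle

/-- A multigraph is toroidal if it embeds into the torus. -/
def Toroidal {α β : Type*} (G : Graph α β) : Prop := Nonempty (Embedding G Torus)

/-! ### Cycles and girth of multigraphs -/

/-- `G` contains a cycle of length `n`; a loop is a cycle of length one, and two parallel edges
form a cycle of length two. -/
def HasCycle {α β : Type*} (G : Graph α β) (n : ℕ) : Prop :=
  0 < n ∧ ∃ (v : ZMod n → α) (c : ZMod n → β), Function.Injective v ∧ Function.Injective c ∧
    ∀ i, G.IsLink (c i) (v i) (v (i + 1))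

/-- The length of a shortest cycle (infinite if there is none). -/
noncomputable def girth {α β : Type*} (G : Graph α β) : ℕ∞ :=
  ⨅ n : {n : ℕ // HasCycle G n}, ((n : ℕ) : ℕ∞)

/-! ### Adding an edge to a graph -/

/-- The choices of an edge `e` that can be added to a graph `G`. -/
inductive EdgeChoice {V : Type*} (G : SimpleGraph V) : Type _
  /-- Subdivide the edge `xy` once by `u`; add a vertex `v`, the edge `uv` and a loop at `v`. -/
  | pendant (x y : V) (h : G.Adj x y)
  /-- Subdivide the edge `xy` twice by `u` and `v`; add a further edge `uv`. -/
  | same (x y : V) (h : G.Adj x y)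
  /-- Subdivide the distinct edges `x₁y₁` by `u` and `x₂y₂` by `v`; add the edge `uv`. -/
  | across (x₁ y₁ x₂ y₂ : V) (h₁ : G.Adj x₁ y₁) (h₂ : G.Adj x₂ y₂) (hne : s(x₁, y₁) ≠ s(x₂, y₂))

namespace EdgeChoice

variable {V : Type*} {G : SimpleGraph V}

/-- The edges of `G` to which `e` is attached, that is, which are subdivided. -/
def attached : EdgeChoice G → Set (Sym2 V)
  | pendant x y _ => {s(x, y)}
  | same x y _ => {s(x, y)}
  | across x₁ y₁ x₂ y₂ _ _ _ => {s(x₁, y₁), s(x₂, y₂)}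

/-- The list of edges of `G ∪ e` that are not edges of `G`, where `u` is `Sum.inr 0` and `v` is
`Sum.inr 1`. -/
def newEdges : EdgeChoice G → List (Sym2 (V ⊕ Fin 2))
  | pendant x y _ =>
      [s(.inl x, .inr 0), s(.inr 0, .inl y), s(.inr 0, .inr 1), s(.inr 1, .inr 1)]
  | same x y _ =>
      [s(.inl x, .inr 0), s(.inr 0, .inr 1), s(.inr 1, .inl y), s(.inr 0, .inr 1)]
  | across x₁ y₁ x₂ y₂ _ _ _ =>
      [s(.inl x₁, .inr 0), s(.inr 0, .inl y₁), s(.inl x₂, .inr 1), s(.inr 1, .inl y₂),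
        s(.inr 0, .inr 1)]

/-- The incidence relation of `G ∪ e`. An edge is labelled either by an edge of `G` which is not
subdivided, or by its position in the list of new edges. -/
def Link (e : EdgeChoice G) : Sym2 V ⊕ ℕ → V ⊕ Fin 2 → V ⊕ Fin 2 → Prop
  | .inl f, a, b => f ∈ G.edgeSet ∧ f ∉ e.attached ∧ f.map Sum.inl = s(a, b)
  | .inr i, a, b => e.newEdges[i]? = some s(a, b)

end EdgeChoice

/-- The multigraph `G ∪ e`. -/
def addEdge {V : Type*} (G : SimpleGraph V) (e : EdgeChoice G) :
    Graph (V ⊕ Fin 2) (Sym2 V ⊕ ℕ) where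
  vertexSet := Set.univ
  IsLink := e.Link
  isLink_symm := by
    rintro (f | i) - <;> constructor <;> intro a b h
    · exact ⟨h.1, h.2.1, h.2.2.trans Sym2.eq_swap⟩
    · exact Eq.trans h (congrArg some Sym2.eq_swap)
  eq_or_eq_of_isLink_of_isLink := by
    rintro (f | i) x y v w h h'
    · have := h.2.2.symm.trans h'.2.2
      rw [Sym2.eq_iff] at this
      tauto
    · have := Option.some.inj (Eq.trans (Eq.symm h) h')
      rw [Sym2.eq_iff] at this
      tauto
  left_mem_of_isLink := fun _ _ _ _ => Set.mem_univ _

/-! ### The graph `F₁₃` -/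

/-- The vertices `A`, `B`, `C` are `Sum.inl 0`, `Sum.inl 1`, `Sum.inl 2`; the vertex `i`, for
`1 ≤ i ≤ 9`, is `Sum.inr i` with `i` read modulo `9`. -/
abbrev F13Vertex : Type := Fin 3 ⊕ Fin 9

namespace F13Vertex

abbrev A : F13Vertex := .inl 0
abbrev B : F13Vertex := .inl 1
abbrev C : F13Vertex := .inl 2
/-- The vertex with label `i` on the nine-cycle. -/
abbrev r (i : Fin 9) : F13Vertex := .inr i

end F13Vertex

open F13Vertex

/-- The edges of `F₁₃`, each listed once: the nine-cycle `12…9`, and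
`A1, A4, A7, B2, B5, B8, C3, C6, C9`. -/
def f13Edges : Finset (Sym2 F13Vertex) :=
  {s(r 1, r 2), s(r 2, r 3), s(r 3, r 4), s(r 4, r 5), s(r 5, r 6), s(r 6, r 7), s(r 7, r 8),
    s(r 8, r 9), s(r 9, r 1), s(A, r 1), s(A, r 4), s(A, r 7), s(B, r 2), s(B, r 5), s(B, r 8),
    s(C, r 3), s(C, r 6), s(C, r 9)}

/-- The cubic graph `F₁₃` on twelve vertices. -/
def F13 : SimpleGraph F13Vertex where
  Adj x y := s(x, y) ∈ f13Edges
  symm := ⟨fun x y h => by rwa [Sym2.eq_swap]⟩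
  loopless := ⟨by decide⟩

instance : DecidableRel F13.Adj := fun x y => inferInstanceAs (Decidable (s(x, y) ∈ f13Edges))

/-- The ten choices `A1-B2`, `A1-C3`, `A1-B5`, `A1-23`, `A1-34`, `A1-45`, `A1-56`, `12-34`, `12-45`,
`12-56`. -/
def tenCases : Fin 10 → EdgeChoice F13 :=
  ![.across A (r 1) B (r 2) (by decide) (by decide) (by decide),
    .across A (r 1) C (r 3) (by decide) (by decide) (by decide),
    .across A (r 1) B (r 5) (by decide) (by decide) (by decide),
    .across A (r 1) (r 2) (r 3) (by decide) (by decide) (by decide),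
    .across A (r 1) (r 3) (r 4) (by decide) (by decide) (by decide),
    .across A (r 1) (r 4) (r 5) (by decide) (by decide) (by decide),
    .across A (r 1) (r 5) (r 6) (by decide) (by decide) (by decide),
    .across (r 1) (r 2) (r 3) (r 4) (by decide) (by decide) (by decide),
    .across (r 1) (r 2) (r 4) (r 5) (by decide) (by decide) (by decide),
    .across (r 1) (r 2) (r 5) (r 6) (by decide) (by decide) (by decide)]

end ToroidalGraphs

/-!
`F₁₃` is drawn on the torus with straight edges, and the dihedral group of order eighteen acts on
`F₁₃`. Moving the drawing by this group, one can assume that the edges to which `e` is attached are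
one of finitely many representatives, and for each of these the new edge is a polygonal line that
avoids the drawing. Two segments of the torus are disjoint if a segment of the plane is separated by
linear functionals from all translates of another one by neighbouring periods, which is a
computation with integers.

Since `F₁₃` has no triangles, the girth of `F₁₃ ∪ e` is at least four as soon as `e` joins two
disjoint edges, and otherwise adding `e` creates a cycle of length at most three. The ten orbits of
pairs of disjoint edges are told apart by an invariant: the sum over all vertices of the cubes of
the numbers of walks of length three to the ends of the two edges.
-/

namespace ToroidalGraphs

open Function Set Graph F13Vertex

/-! ### Open arcs -/

section OpenArc

variable {X : Type*} [TopologicalSpace X] {S T : Set X} {x y z p q : X}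

/-- `S` is the interior of a simple curve in `X` whose ends, possibly equal, are the members of
`z`. Ends are unordered since the edges of a graph are, and the interval of parameters is arbitrary
so that arcs can be cut and glued without rescaling. -/
def IsOpenArc (S : Set X) (z : Sym2 X) : Prop :=
  ∃ (f : ℝ → X) (a b : ℝ), a < b ∧ ContinuousOn f (Icc a b) ∧ InjOn f (Ioo a b) ∧
    f '' Ioo a b = S ∧ s(f a, f b) = z

theorem IsOpenArc.exists_param (h : IsOpenArc S s(x, y)) (c : ℝ) :
    ∃ (f : ℝ → X) (d : ℝ), c < d ∧ ContinuousOn f (Icc c d) ∧ InjOn f (Ioo c d) ∧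
      f '' Ioo c d = S ∧ f c = x ∧ f d = y := by
  obtain ⟨f, a, b, hab, hcont, hinj, rfl, hends⟩ := h
  suffices ∃ φ : ℝ → ℝ, Continuous φ ∧ Injective φ ∧ φ '' Icc c (c + b - a) = Icc a b ∧
      φ '' Ioo c (c + b - a) = Ioo a b ∧ f (φ c) = x ∧ f (φ (c + b - a)) = y by
    obtain ⟨φ, hφ, hφinj, hIcc, hIoo, hx, hy⟩ := this
    exact ⟨f ∘ φ, c + b - a, by linarith,
      hcont.comp hφ.continuousOn (hIcc ▸ mapsTo_image φ _),
      hinj.comp hφinj.injOn (hIoo ▸ mapsTo_image φ _), by rw [image_comp, hIoo], hx, hy⟩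
  obtain ⟨rfl, rfl⟩ | ⟨rfl, rfl⟩ := Sym2.eq_iff.1 hends
  · exact ⟨fun t => t + (a - c), by fun_prop, add_left_injective _,
      by simp only [image_add_const_Icc]; ring_nf, by simp only [image_add_const_Ioo]; ring_nf,
      by ring_nf, by ring_nf⟩
  · exact ⟨fun t => b + c - t, by fun_prop, sub_right_injective,
      by simp only [image_const_sub_Icc]; ring_nf, by simp only [image_const_sub_Ioo]; ring_nf,
      by ring_nf, by ring_nf⟩

theorem IsOpenArc.exists_split (h : IsOpenArc S s(x, y)) (hp : p ∈ S) :
    ∃ S₁ S₂, IsOpenArc S₁ s(x, p) ∧ IsOpenArc S₂ s(p, y) ∧ {p} ∪ S₁ ∪ S₂ = S ∧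
      [{p}, S₁, S₂].Pairwise Disjoint := by
  obtain ⟨f, b, -, hcont, hinj, rfl, rfl, rfl⟩ := h.exists_param 0
  obtain ⟨c, ⟨hc, hcb⟩, rfl⟩ := hp
  have hleft : Ioo 0 c ⊆ Ioo 0 b := Ioo_subset_Ioo_right hcb.le
  have hright : Ioo c b ⊆ Ioo 0 b := Ioo_subset_Ioo_left hc.le
  have hmid : {c} ⊆ Ioo 0 b := singleton_subset_iff.2 ⟨hc, hcb⟩
  refine ⟨f '' Ioo 0 c, f '' Ioo c b,
    ⟨f, 0, c, hc, hcont.mono (Icc_subset_Icc_right hcb.le), hinj.mono hleft, rfl, rfl⟩,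
    ⟨f, c, b, hcb, hcont.mono (Icc_subset_Icc_left hc.le), hinj.mono hright, rfl, rfl⟩, ?_, ?_⟩
  · rw [← image_singleton, ← image_union, ← image_union]
    congr 1
    grind
  · simp only [List.pairwise_cons, ← image_singleton (f := f), List.forall_mem_cons,
      List.not_mem_nil, IsEmpty.forall_iff, implies_true, List.Pairwise.nil, and_true]
    refine ⟨⟨Disjoint.image ?_ hinj hmid hleft, Disjoint.image ?_ hinj hmid hright⟩,
      Disjoint.image ?_ hinj hleft hright⟩ <;> grind

theorem IsOpenArc.exists_split_two (h : IsOpenArc S s(x, y)) (hp : p ∈ S) (hq : q ∈ S)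
    (hpq : p ≠ q) :
    ∃ u v S₁ S₂ S₃, s(u, v) = s(p, q) ∧ IsOpenArc S₁ s(x, u) ∧ IsOpenArc S₂ s(u, v) ∧
      IsOpenArc S₃ s(v, y) ∧ {u} ∪ {v} ∪ S₁ ∪ S₂ ∪ S₃ = S ∧
      [{u}, {v}, S₁, S₂, S₃].Pairwise Disjoint := by
  obtain ⟨L, R, hL, hR, rfl, hdisj⟩ := h.exists_split hp
  obtain (hqp | hqL) | hqR := hq
  · exact absurd hqp.symm hpq
  · obtain ⟨S₁, S₂, h₁, h₂, rfl, hdisj'⟩ := hL.exists_split hqL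
    refine ⟨q, p, S₁, S₂, R, Sym2.eq_swap, h₁, h₂, hR, by grind, ?_⟩
    simp only [List.pairwise_cons, List.forall_mem_cons, disjoint_union_left,
      disjoint_union_right] at hdisj hdisj' ⊢
    grind [Disjoint.symm]
  · obtain ⟨S₂, S₃, h₂, h₃, rfl, hdisj'⟩ := hR.exists_split hqR
    refine ⟨p, q, L, S₂, S₃, rfl, hL, h₂, h₃, by grind, ?_⟩
    simp only [List.pairwise_cons, List.forall_mem_cons, disjoint_union_left,
      disjoint_union_right] at hdisj hdisj' ⊢
    grind [Disjoint.symm]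

theorem IsOpenArc.trans (hS : IsOpenArc S s(x, y)) (hT : IsOpenArc T s(y, z))
    (hyS : y ∉ S) (hyT : y ∉ T) (hST : Disjoint S T) :
    IsOpenArc (S ∪ {y} ∪ T) s(x, z) := by
  obtain ⟨f, b, hb, hf, hfinj, rfl, rfl, hfb⟩ := hS.exists_param 0
  obtain ⟨g, d, hbd, hg, hginj, rfl, rfl, rfl⟩ := hT.exists_param b
  let h : ℝ → X := fun t => if t ≤ b then f t else g t
  have hhf : EqOn h f (Iic b) := fun t ht => if_pos ht
  have hhg : EqOn h g (Ici b) := fun t ht => by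
    obtain rfl | hlt := (mem_Ici.1 ht).eq_or_lt
    · simp [h, hfb]
    · exact if_neg hlt.not_ge
  have himage₁ : h '' Ioo 0 b = f '' Ioo 0 b := (hhf.mono fun t ht => ht.2.le).image_eq
  have himage₂ : h '' Ioo b d = g '' Ioo b d := (hhg.mono fun t ht => ht.1.le).image_eq
  have hIoo : Ioo 0 d = Ioo 0 b ∪ {b} ∪ Ioo b d := by grind
  refine ⟨h, 0, d, hb.trans hbd, ?_, ?_, ?_, ?_⟩
  · rw [← Icc_union_Icc_eq_Icc hb.le hbd.le]
    exact (hf.congr (hhf.mono fun t ht => ht.2)).union_of_isClosed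
      (hg.congr (hhg.mono fun t ht => ht.1)) isClosed_Icc isClosed_Icc
  · rw [hIoo, injOn_union (by grind), injOn_union (by grind)]
    refine ⟨⟨hfinj.congr (hhf.mono fun t ht => ht.2.le).symm, injOn_singleton _ _, ?_⟩,
      hginj.congr (hhg.mono fun t ht => ht.1.le).symm, ?_⟩
    · rintro s hs _ rfl heq
      exact hyS (hhg self_mem_Ici ▸ heq ▸ himage₁ ▸ mem_image_of_mem h hs)
    · rintro s (hs | rfl) t ht heq
      · exact disjoint_left.1 hST (himage₁ ▸ mem_image_of_mem h hs)
          (heq ▸ himage₂ ▸ mem_image_of_mem h ht)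
      · exact hyT (hhg self_mem_Ici ▸ heq ▸ himage₂ ▸ mem_image_of_mem h ht)
  · rw [hIoo, image_union, image_union, himage₁, himage₂, image_singleton, hhg self_mem_Ici]
  · rw [hhf hb.le, hhg hbd.le]

theorem IsOpenArc.exists_continuousMap (h : IsOpenArc S s(x, y)) :
    ∃ f : C(unitInterval, X), f 0 = x ∧ f 1 = y ∧ InjOn f (Ioo 0 1) ∧ MapsTo f (Ioo 0 1) S := by
  obtain ⟨f, b, hb, hcont, hinj, rfl, rfl, rfl⟩ := h.exists_param 0
  have hIcc : ∀ t : unitInterval, b * t ∈ Icc 0 b := fun t =>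
    ⟨mul_nonneg hb.le t.2.1, mul_le_of_le_one_right hb.le t.2.2⟩
  have hIoo : MapsTo (fun t : unitInterval => b * t) (Ioo 0 1) (Ioo 0 b) := fun t ht =>
    ⟨mul_pos hb (Subtype.coe_lt_coe.2 ht.1), mul_lt_of_lt_one_right hb (Subtype.coe_lt_coe.2 ht.2)⟩
  exact ⟨⟨fun t => f (b * t), hcont.comp_continuous (by fun_prop) hIcc⟩, by simp, by simp,
    hinj.comp ((mul_right_injective₀ hb.ne').comp Subtype.val_injective).injOn hIoo,
    fun t ht => mem_image_of_mem f (hIoo ht)⟩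

end OpenArc

/-! ### Drawings of graphs -/

section Drawing

variable {V W X : Type*} [TopologicalSpace X] {G : SimpleGraph V} {H : SimpleGraph W}

theorem nonempty_embedding_of_isOpenArc [Nonempty X] {α β : Type*} {Γ : Graph α β} (vert : α → X)
    (region : β → Set X) (hvert : InjOn vert V(Γ))
    (harc : ∀ e x y, Γ.IsLink e x y → IsOpenArc (region e) s(vert x, vert y))
    (hregion : ∀ e ∈ E(Γ), ∀ x ∈ V(Γ), vert x ∉ region e)
    (hdisj : E(Γ).PairwiseDisjoint region) : Nonempty (Embedding Γ X) := by
  have hcurve : ∀ e, ∃ f : C(unitInterval, X), e ∈ E(Γ) →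
      InjOn f (Ioo 0 1) ∧ MapsTo f (Ioo 0 1) (region e) ∧
      ∀ x y, Γ.IsLink e x y → (f 0 = vert x ∧ f 1 = vert y) ∨ (f 0 = vert y ∧ f 1 = vert x) := by
    intro e
    by_cases he : e ∈ E(Γ)
    · obtain ⟨x, y, hxy⟩ := exists_isLink_of_mem_edgeSet he
      obtain ⟨f, hx, hy, hinj, hmaps⟩ := (harc e x y hxy).exists_continuousMap
      refine ⟨f, fun _ => ⟨hinj, hmaps, fun x' y' hxy' => ?_⟩⟩
      obtain ⟨rfl, rfl⟩ | ⟨rfl, rfl⟩ := hxy.eq_and_eq_or_eq_and_eq hxy'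
      exacts [.inl ⟨hx, hy⟩, .inr ⟨hx, hy⟩]
    · exact ⟨.const _ (Classical.arbitrary X), fun h => absurd h he⟩
  choose arc harc' using hcurve
  exact ⟨{
    vert := vert
    arc := arc
    vert_injOn := hvert
    arc_ends := fun e x y h => (harc' e h.edge_mem).2.2 x y h
    arc_injOn := fun e he => (harc' e he).1
    arc_ne_vert := fun e he t ht x hx heq => hregion e he x hx (heq ▸ (harc' e he).2.1 ht)
    arc_ne_arc := fun e he f hf hef s hs t ht =>
      (hdisj he hf hef).ne_of_mem ((harc' e he).2.1 hs) ((harc' f hf).2.1 ht) }⟩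

/-- A crossing-free drawing of the simple graph `G` in `X`, given by the images of its vertices and
the interiors of its edges. In contrast to `Embedding`, no parametrisation of the edges is chosen,
so that a drawing can be transported along a graph isomorphism. -/
structure Drawing (G : SimpleGraph V) (X : Type*) [TopologicalSpace X] where
  point : V → X
  line : Sym2 V → Set X
  point_injective : Injective point
  isOpenArc_line : ∀ f ∈ G.edgeSet, IsOpenArc (line f) (f.map point)
  point_notMem_line : ∀ f ∈ G.edgeSet, ∀ v, point v ∉ line f
  pairwiseDisjoint_line : G.edgeSet.PairwiseDisjoint line

namespace Drawing

/-- The part of `X` that is not covered by the drawing once the edges in `A` are erased. -/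
def complement (D : Drawing G X) (A : Set (Sym2 V)) : Set X :=
  (range D.point ∪ ⋃ f ∈ G.edgeSet \ A, D.line f)ᶜ

theorem mem_complement {D : Drawing G X} {A : Set (Sym2 V)} {z : X} :
    z ∈ D.complement A ↔ (∀ v, z ≠ D.point v) ∧ ∀ f ∈ G.edgeSet, f ∉ A → z ∉ D.line f := by
  simp [complement, eq_comm]

theorem complement_mono (D : Drawing G X) : Monotone D.complement := fun _ _ hAB _ hz =>
  have ⟨hpoint, hline⟩ := mem_complement.1 hz
  mem_complement.2 ⟨hpoint, fun f hf hfB => hline f hf fun hfA => hfB (hAB hfA)⟩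

theorem line_subset_complement (D : Drawing G X) {A : Set (Sym2 V)} {f : Sym2 V}
    (hf : f ∈ G.edgeSet) (hfA : f ∈ A) : D.line f ⊆ D.complement A := fun _ hz =>
  mem_complement.2 ⟨fun v hv => D.point_notMem_line f hf v (hv ▸ hz), fun _ hg hgA hzg =>
    disjoint_left.1 (D.pairwiseDisjoint_line hf hg fun h => hgA (h ▸ hfA)) hz hzg⟩

/-- The drawing of `G` obtained from a drawing of `H` by relabelling. -/
def comap (D : Drawing H X) (σ : G ≃g H) : Drawing G X where
  point := D.point ∘ σ
  line f := D.line (f.map σ)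
  point_injective := D.point_injective.comp σ.injective
  isOpenArc_line f hf := by
    simpa [Sym2.map_map] using D.isOpenArc_line _ (σ.map_mem_edgeSet_iff.2 hf)
  point_notMem_line f hf v := D.point_notMem_line _ (σ.map_mem_edgeSet_iff.2 hf) (σ v)
  pairwiseDisjoint_line _ hf _ hg hfg := D.pairwiseDisjoint_line
    (σ.map_mem_edgeSet_iff.2 hf) (σ.map_mem_edgeSet_iff.2 hg)
    ((Sym2.map.injective σ.injective).ne hfg)

theorem complement_subset_complement_comap (D : Drawing H X) (σ : G ≃g H) (A : Set (Sym2 W)) :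
    D.complement A ⊆ (D.comap σ).complement (Sym2.map σ ⁻¹' A) := fun _ hz =>
  have ⟨hpoint, hline⟩ := mem_complement.1 hz
  mem_complement.2 ⟨fun v => hpoint (σ v), fun _ hf => hline _ (σ.map_mem_edgeSet_iff.2 hf)⟩

theorem disjoint_line_complement (D : Drawing G X) {A : Set (Sym2 V)} {f : Sym2 V}
    (hf : f ∈ G.edgeSet) (hfA : f ∉ A) : Disjoint (D.line f) (D.complement A) :=
  disjoint_right.2 fun _ hz => (mem_complement.1 hz).2 f hf hfA

/-- The edges `f` and `g`, which may be equal, can be joined by a new edge that does not cross the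
drawing and is attached to inner points of `f` and `g`. -/
def HasChord (D : Drawing G X) (f g : Sym2 V) : Prop :=
  ∃ p ∈ D.line f, ∃ q ∈ D.line g, p ≠ q ∧ ∃ T ⊆ D.complement ∅, IsOpenArc T s(p, q)

/-- A loop at a new vertex `v` that is joined to an inner point of the edge `f` can be drawn without
crossings. -/
def HasLollipop (D : Drawing G X) (f : Sym2 V) : Prop :=
  ∃ p ∈ D.line f, ∃ v T L, IsOpenArc T s(p, v) ∧ IsOpenArc L s(v, v) ∧
    [{v}, T, L].Pairwise Disjoint ∧ ∀ S ∈ [{v}, T, L], S ⊆ D.complement ∅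

theorem HasChord.symm {D : Drawing G X} {f g : Sym2 V} (h : D.HasChord f g) : D.HasChord g f :=
  have ⟨p, hp, q, hq, hpq, T, hT, harc⟩ := h
  ⟨q, hq, p, hp, hpq.symm, T, hT, Sym2.eq_swap ▸ harc⟩

theorem HasChord.comap {D : Drawing H X} {σ : G ≃g H} {f g : Sym2 V}
    (h : D.HasChord (f.map σ) (g.map σ)) : (D.comap σ).HasChord f g :=
  have ⟨p, hp, q, hq, hpq, T, hT, harc⟩ := h
  ⟨p, hp, q, hq, hpq, T, hT.trans (D.complement_subset_complement_comap σ ∅), harc⟩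

theorem HasLollipop.comap {D : Drawing H X} {σ : G ≃g H} {f : Sym2 V}
    (h : D.HasLollipop (f.map σ)) : (D.comap σ).HasLollipop f :=
  have ⟨p, hp, v, T, L, hT, hL, hdisj, hcompl⟩ := h
  ⟨p, hp, v, T, L, hT, hL, hdisj, fun S hS =>
    (hcompl S hS).trans (D.complement_subset_complement_comap σ ∅)⟩

theorem nonempty_embedding_addEdge [Nonempty X] (D : Drawing G X) (e : EdgeChoice G)
    (w : Fin 2 → X) (R : ℕ → Set X)
    (hR : ∀ i z, e.newEdges[i]? = some z → IsOpenArc (R i) (z.map (Sum.elim D.point w)))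
    (hw : Injective w) (hwR : ∀ i j, w j ∉ R i) (hRR : Pairwise (Disjoint on R))
    (hwc : ∀ j, w j ∈ D.complement e.attached) (hRc : ∀ i, R i ⊆ D.complement e.attached) :
    Nonempty (Embedding (addEdge G e) X) := by
  have hinl : ∀ f, Sum.inl f ∈ E(addEdge G e) → f ∈ G.edgeSet ∧ f ∉ e.attached := fun f hf =>
    have ⟨_, _, hlink⟩ := exists_isLink_of_mem_edgeSet hf
    ⟨hlink.1, hlink.2.1⟩
  have hline : ∀ f i, Sum.inl f ∈ E(addEdge G e) → Disjoint (D.line f) (R i) := fun f i hf =>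
    (D.disjoint_line_complement (hinl f hf).1 (hinl f hf).2).mono_right (hRc i)
  refine nonempty_embedding_of_isOpenArc (Sum.elim D.point w) (Sum.elim D.line R)
    (Injective.injOn ?_) ?_ ?_ ?_
  · exact D.point_injective.sumElim hw fun v i h => (mem_complement.1 (hwc i)).1 v h.symm
  · rintro (f | i) x y hlink
    · rw [← Sym2.map_mk, ← hlink.2.2, Sym2.map_map, Sum.elim_comp_inl]
      exact D.isOpenArc_line f hlink.1
    · exact hR i _ hlink
  · rintro (f | i) hf (v | j) -
    · exact D.point_notMem_line f (hinl f hf).1 v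
    · exact (mem_complement.1 (hwc j)).2 f (hinl f hf).1 (hinl f hf).2
    · exact fun hv => (mem_complement.1 (hRc i hv)).1 v rfl
    · exact hwR i j
  · rintro (f | i) hf (g | j) hg hne
    · exact D.pairwiseDisjoint_line (hinl f hf).1 (hinl g hg).1 (by simpa using hne)
    · exact hline f j hf
    · exact (hline g i hg).symm
    · exact hRR (by simpa using hne)

theorem nonempty_embedding_addEdge_of_forall₂ [Nonempty X] (D : Drawing G X) (e : EdgeChoice G)
    (w : Fin 2 → X) (R : List (Set X))
    (hR : List.Forall₂ (fun z S => IsOpenArc S (z.map (Sum.elim D.point w))) e.newEdges R)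
    (hdisj : ({w 0} :: {w 1} :: R).Pairwise Disjoint)
    (hcompl : ∀ S ∈ {w 0} :: {w 1} :: R, S ⊆ D.complement e.attached) :
    Nonempty (Embedding (addEdge G e) X) := by
  simp only [List.pairwise_cons, List.forall_mem_cons, singleton_subset_iff,
    disjoint_singleton_left] at hdisj hcompl
  obtain ⟨⟨hw, hw₀⟩, hw₁, hRR⟩ := hdisj
  obtain ⟨hcompl₀, hcompl₁, hcompl⟩ := hcompl
  have hget : ∀ i, R.getD i ∅ ∈ R ∨ R.getD i ∅ = ∅ := fun i => by
    obtain hi | hi := lt_or_ge i R.length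
    · exact .inl (List.getD_eq_getElem _ _ hi ▸ List.getElem_mem hi)
    · exact .inr (List.getD_eq_default _ _ hi)
  refine D.nonempty_embedding_addEdge e w (fun i => R.getD i ∅) ?_ ?_ ?_
    ?_ (Fin.forall_fin_two.2 ⟨hcompl₀, hcompl₁⟩) ?_
  · intro i z hz
    obtain ⟨hi, rfl⟩ := List.getElem?_eq_some_iff.1 hz
    rw [List.getD_eq_getElem _ _ (hR.length_eq ▸ hi)]
    exact hR.get hi _
  · simpa [Injective, Fin.forall_fin_two, eq_comm] using hw
  · exact fun i => Fin.forall_fin_two.2 (by grind)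
  · exact (pairwise_disjoint_on _).2 fun i j hij => by
      obtain hj | hj := lt_or_ge j R.length
      · rw [List.getD_eq_getElem _ _ hj, List.getD_eq_getElem _ _ (hij.trans hj)]
        exact List.pairwise_iff_getElem.1 hRR i j _ _ hij
      · rw [List.getD_eq_default _ _ hj]
        exact disjoint_bot_right
  · intro i
    obtain hi | hi := hget i
    · exact hcompl _ hi
    · exact hi.trans_subset (empty_subset _)

theorem nonempty_embedding_addEdge_pendant [Nonempty X] (D : Drawing G X) {x y : V}
    (hxy : G.Adj x y) (h : D.HasLollipop s(x, y)) :
    Nonempty (Embedding (addEdge G (.pendant x y hxy)) X) := by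
  obtain ⟨p, hp, v, T, L, hT, hL, hdisj, hcompl⟩ := h
  obtain ⟨S₁, S₂, h₁, h₂, hunion, hS⟩ := (D.isOpenArc_line s(x, y) hxy).exists_split hp
  have hline : ∀ S ∈ [{p}, S₁, S₂], S ⊆ D.line s(x, y) := by
    simpa [insert_subset_iff, and_assoc, and_left_comm] using hunion.subset
  have hperm : ([{p}, S₁, S₂] ++ [{v}, T, L]).Perm [{p}, {v}, S₁, S₂, T, L] :=
    (List.perm_middle (l₁ := [S₁, S₂])).cons _
  refine D.nonempty_embedding_addEdge_of_forall₂ _ ![p, v] [S₁, S₂, T, L] ?_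
    (hperm.pairwise (List.pairwise_append.2 ⟨hS, hdisj, fun S hS S' hS' => ?_⟩) fun h => h.symm)
    fun S hS => ?_
  · simpa [EdgeChoice.newEdges] using ⟨h₁, h₂, hT, hL⟩
  · exact (D.disjoint_line_complement hxy (notMem_empty _)).mono (hline S hS) (hcompl S' hS')
  · obtain hS | hS := List.mem_append.1 (hperm.mem_iff.2 hS)
    · exact (hline S hS).trans (D.line_subset_complement hxy rfl)
    · exact (hcompl S hS).trans (D.complement_mono (empty_subset _))

theorem nonempty_embedding_addEdge_same [Nonempty X] (D : Drawing G X) {x y : V}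
    (hxy : G.Adj x y) (h : D.HasChord s(x, y) s(x, y)) :
    Nonempty (Embedding (addEdge G (.same x y hxy)) X) := by
  obtain ⟨p, hp, q, hq, hpq, T, hcompl, hT⟩ := h
  obtain ⟨u, v, S₁, S₂, S₃, huv, h₁, h₂, h₃, hunion, hS⟩ :=
    (D.isOpenArc_line s(x, y) hxy).exists_split_two hp hq hpq
  rw [← huv] at hT
  have hline : ∀ S ∈ [{u}, {v}, S₁, S₂, S₃], S ⊆ D.line s(x, y) := by
    simpa [insert_subset_iff, and_assoc, and_left_comm] using hunion.subset
  refine D.nonempty_embedding_addEdge_of_forall₂ _ ![u, v] [S₁, S₂, S₃, T] ?_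
    (List.pairwise_append.2 ⟨hS, List.pairwise_singleton _ T, fun S hS S' hS' => ?_⟩)
    fun S hS => ?_
  · simpa [EdgeChoice.newEdges] using ⟨h₁, h₂, h₃, hT⟩
  · rw [List.mem_singleton.1 hS']
    exact (D.disjoint_line_complement hxy (notMem_empty _)).mono (hline S hS) hcompl
  · obtain hS | hS := (List.mem_append (s := [{u}, {v}, S₁, S₂, S₃])).1 hS
    · exact (hline S hS).trans (D.line_subset_complement hxy rfl)
    · rw [List.mem_singleton.1 hS]
      exact hcompl.trans (D.complement_mono (empty_subset _))

theorem nonempty_embedding_addEdge_across [Nonempty X] (D : Drawing G X) {x₁ y₁ x₂ y₂ : V}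
    (h₁ : G.Adj x₁ y₁) (h₂ : G.Adj x₂ y₂) (hne : s(x₁, y₁) ≠ s(x₂, y₂))
    (h : D.HasChord s(x₁, y₁) s(x₂, y₂)) :
    Nonempty (Embedding (addEdge G (.across x₁ y₁ x₂ y₂ h₁ h₂ hne)) X) := by
  obtain ⟨p, hp, q, hq, -, T, hcompl, hT⟩ := h
  obtain ⟨P₁, P₂, hP₁, hP₂, hunionP, hP⟩ := (D.isOpenArc_line s(x₁, y₁) h₁).exists_split hp
  obtain ⟨Q₁, Q₂, hQ₁, hQ₂, hunionQ, hQ⟩ := (D.isOpenArc_line s(x₂, y₂) h₂).exists_split hq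
  have hlineP : ∀ S ∈ [{p}, P₁, P₂], S ⊆ D.line s(x₁, y₁) := by
    simpa [insert_subset_iff, and_assoc, and_left_comm] using hunionP.subset
  have hlineQ : ∀ S ∈ [{q}, Q₁, Q₂], S ⊆ D.line s(x₂, y₂) := by
    simpa [insert_subset_iff, and_assoc, and_left_comm] using hunionQ.subset
  have hperm : ([{p}, P₁, P₂] ++ ([{q}, Q₁, Q₂] ++ [T])).Perm [{p}, {q}, P₁, P₂, Q₁, Q₂, T] :=
    (List.perm_middle (l₁ := [P₁, P₂])).cons _
  have hdisj : ([{p}, P₁, P₂] ++ ([{q}, Q₁, Q₂] ++ [T])).Pairwise Disjoint := by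
    refine List.pairwise_append.2 ⟨hP, List.pairwise_append.2 ⟨hQ, List.pairwise_singleton _ T,
      fun S hS S' hS' => ?_⟩, fun S hS => List.forall_mem_append.2
      ⟨fun S' hS' => (D.pairwiseDisjoint_line h₁ h₂ hne).mono (hlineP S hS) (hlineQ S' hS'),
        fun S' hS' => ?_⟩⟩ <;> rw [List.mem_singleton.1 hS']
    · exact (D.disjoint_line_complement h₂ (notMem_empty _)).mono (hlineQ S hS) hcompl
    · exact (D.disjoint_line_complement h₁ (notMem_empty _)).mono (hlineP S hS) hcompl
  refine D.nonempty_embedding_addEdge_of_forall₂ _ ![p, q] [P₁, P₂, Q₁, Q₂, T] ?_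
    (hperm.pairwise hdisj fun h => h.symm) fun S hS => ?_
  · simpa [EdgeChoice.newEdges] using ⟨hP₁, hP₂, hQ₁, hQ₂, hT⟩
  · obtain hS | hS := List.mem_append.1 (hperm.mem_iff.2 hS)
    · exact (hlineP S hS).trans (D.line_subset_complement h₁ (.inl rfl))
    obtain hS | hS := List.mem_append.1 hS
    · exact (hlineQ S hS).trans (D.line_subset_complement h₂ (.inr rfl))
    · rw [List.mem_singleton.1 hS]
      exact hcompl.trans (D.complement_mono (empty_subset _))

end Drawing

end Drawing

/-! ### Drawings on the torus by segments -/

section Torus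

variable {N : ℕ}

/-- The inclusion of the integral points into the plane. -/
def toPlane : ℤ × ℤ →+ ℝ × ℝ := (Int.castAddHom ℝ).prodMap (Int.castAddHom ℝ)

theorem toPlane_fst (p : ℤ × ℤ) : (toPlane p).1 = p.1 := rfl

theorem toPlane_snd (p : ℤ × ℤ) : (toPlane p).2 = p.2 := rfl

theorem toPlane_injective : Injective toPlane := Int.cast_injective.prodMap Int.cast_injective

/-- The point of the torus with the given coordinates, measured in units of `1 / N`. -/
noncomputable def torusPoint (N : ℕ) (x : ℝ × ℝ) : Torus :=
  (((x.1 / N : ℝ) : UnitAddCircle), ((x.2 / N : ℝ) : UnitAddCircle))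

/-- The point of the torus with the given integral coordinates, measured in units of `1 / N`. -/
noncomputable def gridPoint (N : ℕ) (p : ℤ × ℤ) : Torus := torusPoint N (toPlane p)

theorem continuous_torusPoint (N : ℕ) : Continuous (torusPoint N) :=
  have hcoe : Continuous ((↑) : ℝ → UnitAddCircle) := AddCircle.continuous_mk' 1
  (hcoe.comp (by fun_prop)).prodMk (hcoe.comp (by fun_prop))

theorem coe_div_eq_coe_div_iff [NeZero N] {a b : ℝ} :
    ((a / N : ℝ) : UnitAddCircle) = ((b / N : ℝ) : UnitAddCircle) ↔ ∃ m : ℤ, a = b + N * m := by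
  have hN : (N : ℝ) ≠ 0 := NeZero.ne _
  rw [← sub_eq_zero, ← AddCircle.coe_sub, AddCircle.coe_eq_zero_iff]
  refine exists_congr fun m => ?_
  rw [zsmul_one, eq_comm, ← sub_div, div_eq_iff hN, sub_eq_iff_eq_add', mul_comm]

theorem torusPoint_eq_iff [NeZero N] {x y : ℝ × ℝ} :
    torusPoint N x = torusPoint N y ↔ ∃ u : ℤ × ℤ, x = y + toPlane (N • u) := by
  simp [torusPoint, Prod.ext_iff, coe_div_eq_coe_div_iff, Prod.exists, toPlane_fst, toPlane_snd]

/-- The representative of `p` modulo `N`, in the square `[0, N) × [0, N)`. -/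
def residue (N : ℕ) (p : ℤ × ℤ) : ℤ × ℤ := (p.1 % N, p.2 % N)

theorem exists_eq_add_of_residue_eq {p q : ℤ × ℤ} (h : residue N p = residue N q) :
    ∃ u : ℤ × ℤ, p = q + N • u := by
  obtain ⟨m, hm⟩ := Int.modEq_iff_dvd.1 (congrArg Prod.fst h).symm
  obtain ⟨n, hn⟩ := Int.modEq_iff_dvd.1 (congrArg Prod.snd h).symm
  exact ⟨(m, n), Prod.ext (by simp [← hm]) (by simp [← hn])⟩

theorem gridPoint_residue [NeZero N] (p : ℤ × ℤ) : gridPoint N (residue N p) = gridPoint N p := by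
  have hres : residue N (residue N p) = residue N p := by simp [residue]
  obtain ⟨u, hu⟩ := exists_eq_add_of_residue_eq hres
  exact torusPoint_eq_iff.2 ⟨u, by rw [← map_add, ← hu]⟩

/-- A segment of the plane with integral ends. It may be degenerate, so that vertices and edges of
a drawing are treated alike. -/
abbrev Segment : Type := (ℤ × ℤ) × (ℤ × ℤ)

namespace Segment

/-- The open segment as a subset of the plane; a single point if the segment is degenerate. -/
def interior (P : Segment) : Set (ℝ × ℝ) := openSegment ℝ (toPlane P.1) (toPlane P.2)

/-- The image of the open segment in the torus. -/
def carrier (N : ℕ) (P : Segment) : Set Torus := torusPoint N '' P.interior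

theorem carrier_self (N : ℕ) (p : ℤ × ℤ) : carrier N (p, p) = {gridPoint N p} := by
  simp only [carrier, interior, openSegment_same, image_singleton, gridPoint]

theorem gridPoint_mem_carrier [NeZero N] {P : Segment} {q : ℤ × ℤ} (a b : ℕ) [NeZero a] [NeZero b]
    (h : residue ((a + b) * N) (a • P.1 + b • P.2) = residue ((a + b) * N) ((a + b) • q)) :
    gridPoint N q ∈ carrier N P := by
  have ha : (0 : ℝ) < a := by exact_mod_cast NeZero.pos a
  have hb : (0 : ℝ) < b := by exact_mod_cast NeZero.pos b
  obtain ⟨u, hu⟩ := exists_eq_add_of_residue_eq h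
  rw [mul_smul, ← smul_add] at hu
  replace hu := congrArg toPlane hu
  simp only [map_add, map_nsmul, ← Nat.cast_smul_eq_nsmul ℝ] at hu
  refine ⟨_, ⟨a / (a + b), b / (a + b), by positivity, by positivity, by field_simp, rfl⟩,
    torusPoint_eq_iff.2 ⟨u, smul_right_injective _ (add_pos ha hb).ne' ?_⟩⟩
  simp only [smul_add, smul_smul, map_nsmul, ← Nat.cast_smul_eq_nsmul ℝ]
  push_cast at hu
  rw [mul_div_cancel₀ _ (add_pos ha hb).ne', mul_div_cancel₀ _ (add_pos ha hb).ne', hu, smul_add,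
    smul_smul]

/-- The segment is not degenerate and both coordinates change by less than the period along it. -/
def IsShort (N : ℕ) (P : Segment) : Prop :=
  P.1 ≠ P.2 ∧ |P.2.1 - P.1.1| < N ∧ |P.2.2 - P.1.2| < N

instance : DecidablePred (IsShort N) := fun _ => inferInstanceAs (Decidable (_ ∧ _ ∧ _))

theorem IsShort.isOpenArc_carrier [NeZero N] {P : Segment} (h : P.IsShort N) :
    IsOpenArc (P.carrier N) s(gridPoint N P.1, gridPoint N P.2) := by
  obtain ⟨hne, h₁, h₂⟩ := h
  have hline : Injective (AffineMap.lineMap (toPlane P.1) (toPlane P.2) : ℝ → ℝ × ℝ) :=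
    AffineMap.lineMap_injective ℝ (toPlane_injective.ne hne)
  refine ⟨fun t => torusPoint N (AffineMap.lineMap (toPlane P.1) (toPlane P.2) t), 0, 1, one_pos,
    ((continuous_torusPoint N).comp AffineMap.lineMap_continuous).continuousOn, ?_, ?_, ?_⟩
  · intro s hs t ht hst
    have hdist : |s - t| ≤ 1 :=
      abs_sub_le_iff.2 ⟨by linarith [hs.2, ht.1], by linarith [hs.1, ht.2]⟩
    have hzero : ∀ {c m : ℤ}, |c| < N → (s - t) * c = N * m → m = 0 := fun {c m} hc hm => by
      have hlt : |(N * m : ℝ)| < N := by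
        rw [← hm, abs_mul]
        exact (mul_le_of_le_one_left (abs_nonneg _) hdist).trans_lt (by exact_mod_cast hc)
      exact Int.abs_lt_one_iff.1 (by
        rw [abs_mul, Nat.abs_cast] at hlt
        exact_mod_cast lt_of_mul_lt_mul_left (hlt.trans_eq (mul_one _).symm) N.cast_nonneg)
    obtain ⟨⟨m, n⟩, hu⟩ := torusPoint_eq_iff.1 hst
    have hsub : (s - t) • (toPlane P.2 - toPlane P.1) = toPlane (N • (m, n)) := by
      rw [sub_smul, sub_eq_iff_eq_add', ← add_left_inj (toPlane P.1)]
      simpa only [AffineMap.lineMap_apply_module', add_right_comm] using hu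
    obtain rfl : m = 0 := hzero h₁ (by simpa [toPlane_fst] using congrArg Prod.fst hsub)
    obtain rfl : n = 0 := hzero h₂ (by simpa [toPlane_snd] using congrArg Prod.snd hsub)
    exact hline (by simpa only [Prod.mk_zero_zero, smul_zero, map_zero, add_zero] using hu)
  · rw [carrier, interior, openSegment_eq_image_lineMap, image_image]
  · simp [gridPoint]

theorem interior_add (P : Segment) (u : ℤ × ℤ) :
    (P + (u, u)).interior = (· + toPlane u) '' P.interior := by
  simp only [interior, Prod.fst_add, Prod.snd_add, map_add, add_comm _ (toPlane u),
    openSegment_translate_image]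

/-- The value at `p` of the linear functional with coefficients `v`. -/
def dot (v p : ℤ × ℤ) : ℤ := v.1 * p.1 + v.2 * p.2

/-- The functional `v` is larger on the open segment `Q` than on the open segment `P`. -/
def Below (v : ℤ × ℤ) (P Q : Segment) : Prop :=
  (dot v P.1 ≤ dot v Q.1 ∧ dot v P.1 ≤ dot v Q.2 ∧ dot v P.2 ≤ dot v Q.1 ∧ dot v P.2 ≤ dot v Q.2) ∧
    dot v P.1 + dot v P.2 < dot v Q.1 + dot v Q.2

instance (v : ℤ × ℤ) (P Q : Segment) : Decidable (Below v P Q) :=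
  inferInstanceAs (Decidable ((_ ∧ _ ∧ _ ∧ _) ∧ _))

/-- A normal vector of the segment. -/
def normal (P : Segment) : ℤ × ℤ := (P.1.2 - P.2.2, P.2.1 - P.1.1)

/-- Some line which is parallel to an axis or to one of the segments separates them. -/
def Separated (P Q : Segment) : Prop :=
  ∃ v ∈ [(1, 0), (0, 1), P.normal, Q.normal], Below v P Q ∨ Below v Q P

instance (P Q : Segment) : Decidable (Separated P Q) :=
  inferInstanceAs (Decidable (∃ _ ∈ _, _))

theorem Below.disjoint_interior {v : ℤ × ℤ} {P Q : Segment} (h : Below v P Q) :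
    Disjoint P.interior Q.interior := by
  obtain ⟨⟨h₁₁, h₁₂, h₂₁, h₂₂⟩, hlt⟩ := h
  rw [disjoint_left]
  rintro _ ⟨a, b, ha, hb, hab, rfl⟩ ⟨c, d, hc, hd, hcd, heq⟩
  have hdot : a * (dot v P.1 : ℝ) + b * dot v P.2 = c * dot v Q.1 + d * dot v Q.2 := by
    have h₁ : c * Q.1.1 + d * Q.2.1 = (a * P.1.1 + b * P.2.1 : ℝ) := congrArg Prod.fst heq
    have h₂ : c * Q.1.2 + d * Q.2.2 = (a * P.1.2 + b * P.2.2 : ℝ) := congrArg Prod.snd heq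
    simp only [dot, Int.cast_add, Int.cast_mul]
    linear_combination -v.1 * h₁ - v.2 * h₂
  rify at h₁₁ h₁₂ h₂₁ h₂₂ hlt
  generalize (dot v P.1 : ℝ) = p₁ at *
  generalize (dot v P.2 : ℝ) = p₂ at *
  generalize (dot v Q.1 : ℝ) = q₁ at *
  generalize (dot v Q.2 : ℝ) = q₂ at *
  have hsum :
      a * c * (q₁ - p₁) + a * d * (q₂ - p₁) + b * c * (q₁ - p₂) + b * d * (q₂ - p₂) = 0 := by
    linear_combination (c * q₁ + d * q₂) * hab - (a * p₁ + b * p₂) * hcd - hdot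
  have hnonneg₁₁ := mul_nonneg (mul_pos ha hc).le (sub_nonneg.2 h₁₁)
  have hnonneg₁₂ := mul_nonneg (mul_pos ha hd).le (sub_nonneg.2 h₁₂)
  have hnonneg₂₁ := mul_nonneg (mul_pos hb hc).le (sub_nonneg.2 h₂₁)
  have hnonneg₂₂ := mul_nonneg (mul_pos hb hd).le (sub_nonneg.2 h₂₂)
  obtain h | h : p₁ < q₁ ∨ p₂ < q₂ := by by_contra! h; linarith
  · linarith [mul_pos (mul_pos ha hc) (sub_pos.2 h)]
  · linarith [mul_pos (mul_pos hb hd) (sub_pos.2 h)]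

theorem Separated.disjoint_interior {P Q : Segment} (h : Separated P Q) :
    Disjoint P.interior Q.interior := by
  obtain ⟨v, -, hv | hv⟩ := h
  · exact hv.disjoint_interior
  · exact hv.disjoint_interior.symm

/-- The point lies in the square `[0, 2N) × [0, 2N)`. -/
def InBox (N : ℕ) (p : ℤ × ℤ) : Prop :=
  (0 ≤ p.1 ∧ p.1 < 2 * N) ∧ 0 ≤ p.2 ∧ p.2 < 2 * N

instance : DecidablePred (InBox N) := fun _ => inferInstanceAs (Decidable ((_ ∧ _) ∧ _ ∧ _))

theorem interior_subset_of_inBox {P : Segment} (h₁ : InBox N P.1) (h₂ : InBox N P.2) :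
    P.interior ⊆ Ico 0 (2 * N : ℝ) ×ˢ Ico 0 (2 * N : ℝ) := by
  have hmem : ∀ {p}, InBox N p → toPlane p ∈ Ico 0 (2 * N : ℝ) ×ˢ Ico 0 (2 * N : ℝ) :=
    fun {p} ⟨⟨h₀, h₁⟩, h₂, h₃⟩ => by
      refine ⟨⟨?_, ?_⟩, ?_, ?_⟩ <;> simp only [toPlane_fst, toPlane_snd] <;> assumption_mod_cast
  exact ((convex_Ico _ _).prod (convex_Ico _ _)).openSegment_subset (hmem h₁) (hmem h₂)

/-- The segment `P` is separated from the translates of `Q` by the neighbouring periods, which are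
the only ones that can meet it since both lie in the square `[0, 2N) × [0, 2N)`. -/
def Apart (N : ℕ) (P Q : Segment) : Prop :=
  ((InBox N P.1 ∧ InBox N P.2) ∧ InBox N Q.1 ∧ InBox N Q.2) ∧
    ∀ m ∈ [-1, 0, 1], ∀ n ∈ [-1, 0, 1], Separated P (Q + (N • (m, n), N • (m, n)))

instance : DecidableRel (Apart N) := fun _ _ =>
  inferInstanceAs (Decidable (((_ ∧ _) ∧ _ ∧ _) ∧ _))

theorem Apart.disjoint_carrier [NeZero N] {P Q : Segment} (h : Apart N P Q) :
    Disjoint (P.carrier N) (Q.carrier N) := by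
  obtain ⟨⟨⟨hP₁, hP₂⟩, hQ₁, hQ₂⟩, hsep⟩ := h
  rw [disjoint_left]
  rintro _ ⟨x, hx, rfl⟩ ⟨y, hy, hxy⟩
  obtain ⟨⟨m, n⟩, hu⟩ := torusPoint_eq_iff.1 hxy.symm
  have hneighbour : ∀ {s t : ℝ} {k : ℤ}, s ∈ Ico 0 (2 * N : ℝ) → t ∈ Ico 0 (2 * N : ℝ) →
      s = t + N * k → k ∈ [-1, 0, 1] := fun {s t k} hs ht hst => by
    have hN : (0 : ℝ) < N := by exact_mod_cast NeZero.pos N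
    have hlt : (N : ℝ) * -2 < N * k ∧ (N : ℝ) * k < N * 2 :=
      ⟨by linarith [hs.1, ht.2], by linarith [hs.2, ht.1]⟩
    rw [mul_lt_mul_iff_right₀ hN, mul_lt_mul_iff_right₀ hN] at hlt
    norm_cast at hlt
    simp only [List.mem_cons, List.not_mem_nil, or_false]
    omega
  have hm : m ∈ [-1, 0, 1] := hneighbour (interior_subset_of_inBox hP₁ hP₂ hx).1
    (interior_subset_of_inBox hQ₁ hQ₂ hy).1 (by simp [hu, toPlane_fst])
  have hn : n ∈ [-1, 0, 1] := hneighbour (interior_subset_of_inBox hP₁ hP₂ hx).2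
    (interior_subset_of_inBox hQ₁ hQ₂ hy).2 (by simp [hu, toPlane_snd])
  refine disjoint_left.1 (hsep m hm n hn).disjoint_interior hx ?_
  rw [interior_add]
  exact ⟨y, hy, hu.symm⟩

end Segment

open Segment

/-- The union of the images in the torus of finitely many open segments. -/
def region (N : ℕ) (L : List Segment) : Set Torus := ⋃ P ∈ L, P.carrier N

theorem region_cons (P : Segment) (L : List Segment) :
    region N (P :: L) = P.carrier N ∪ region N L := by
  simp only [region, List.mem_cons, iUnion_iUnion_eq_or_left]

theorem disjoint_region [NeZero N] {L M : List Segment} (h : ∀ P ∈ L, ∀ Q ∈ M, Apart N P Q) :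
    Disjoint (region N L) (region N M) := by
  simp only [region, disjoint_iUnion_left, disjoint_iUnion_right]
  exact fun Q hQ P hP => (h P hP Q hQ).disjoint_carrier

/-- The open segments and the inner corners of the polygonal line from `p` through the points of
`l` to `q`. -/
def polyline (p : ℤ × ℤ) : List (ℤ × ℤ) → ℤ × ℤ → List Segment
  | [], q => [(p, q)]
  | r :: l, q => (p, r) :: (r, r) :: polyline r l q

theorem isOpenArc_region_polyline [NeZero N] {p q : ℤ × ℤ} {l : List (ℤ × ℤ)}
    (hshort : (p :: l ++ [q]).IsChain fun a b => IsShort N (a, b))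
    (hapart : (polyline p l q).Pairwise (Apart N)) :
    IsOpenArc (region N (polyline p l q)) s(gridPoint N p, gridPoint N q) := by
  induction l generalizing p with
  | nil =>
    simpa [polyline, region] using (List.isChain_pair.1 hshort).isOpenArc_carrier
  | cons r l ih =>
    obtain ⟨hpr, hshort⟩ := List.isChain_cons_cons.1 hshort
    simp only [polyline, List.pairwise_cons, List.forall_mem_cons] at hapart
    obtain ⟨⟨hprr, hprl⟩, hrl, hapart⟩ := hapart
    rw [polyline, region_cons, region_cons, ← union_assoc, carrier_self]
    refine hpr.isOpenArc_carrier.trans (ih hshort hapart) ?_ ?_ ?_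
    · simpa [carrier_self] using hprr.disjoint_carrier
    · simpa [region_cons, carrier_self, region] using
        disjoint_region (L := [(r, r)]) (by simpa using hrl)
    · simpa [region_cons, region] using disjoint_region (L := [(p, r)]) (by simpa using hprl)

/-- A crossing-free drawing on the torus whose edges are segments and whose vertices have integral
coordinates, measured in units of `1 / N`. -/
structure GridDrawing {V : Type*} (G : SimpleGraph V) (N : ℕ) where
  point : V → ℤ × ℤ
  segment : Sym2 V → Segment
  ends : ∀ f ∈ G.edgeSet,
    f.map (residue N ∘ point) = s(residue N (segment f).1, residue N (segment f).2)
  isShort : ∀ f ∈ G.edgeSet, (segment f).IsShort N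
  apart_point_point : Pairwise fun v w => Apart N (point v, point v) (point w, point w)
  apart_point_segment : ∀ f ∈ G.edgeSet, ∀ v, Apart N (point v, point v) (segment f)
  apart_segment_segment : G.edgeSet.Pairwise fun f g => Apart N (segment f) (segment g)

namespace GridDrawing

variable {V : Type*} {G : SimpleGraph V} [NeZero N]

/-- The drawing in the torus given by a drawing on the grid. -/
noncomputable def toDrawing (D : GridDrawing G N) : Drawing G Torus where
  point v := gridPoint N (D.point v)
  line f := (D.segment f).carrier N
  point_injective v w h := by
    by_contra hvw
    simpa [carrier_self, h] using (D.apart_point_point hvw).disjoint_carrier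
  isOpenArc_line f hf := by
    have hmap := congrArg (Sym2.map (gridPoint N)) (D.ends f hf)
    simp only [Sym2.map_map, Sym2.map_mk, comp_def, gridPoint_residue] at hmap
    exact hmap ▸ (D.isShort f hf).isOpenArc_carrier
  point_notMem_line f hf v := by
    simpa [carrier_self] using (D.apart_point_segment f hf v).disjoint_carrier
  pairwiseDisjoint_line f hf g hg hfg := (D.apart_segment_segment hf hg hfg).disjoint_carrier

theorem region_subset_complement (D : GridDrawing G N) {L : List Segment}
    (hpoint : ∀ P ∈ L, ∀ v, Apart N P (D.point v, D.point v))
    (hsegment : ∀ P ∈ L, ∀ f ∈ G.edgeSet, Apart N P (D.segment f)) :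
    region N L ⊆ D.toDrawing.complement ∅ := by
  refine iUnion₂_subset fun P hP z hz => Drawing.mem_complement.2 ⟨fun v hv => ?_, fun f hf _ => ?_⟩
  · have hdisj := (hpoint P hP v).disjoint_carrier
    rw [carrier_self, disjoint_singleton_right] at hdisj
    exact hdisj (mem_of_eq_of_mem hv.symm hz)
  · exact disjoint_left.1 (hsegment P hP f hf).disjoint_carrier hz

end GridDrawing

/-- The grid point `q` is one of the three points that divide the segment `P` into quarters, up to
translation by periods. -/
def Segment.IsQuarterPoint (N : ℕ) (P : Segment) (q : ℤ × ℤ) : Prop :=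
  ∃ c ∈ [(1, 3), (2, 2), (3, 1)],
    residue (4 * N) (c.1 • P.1 + c.2 • P.2) = residue (4 * N) ((4 : ℕ) • q)

instance (P : Segment) : DecidablePred (IsQuarterPoint N P) := fun _ =>
  inferInstanceAs (Decidable (∃ c ∈ [(1, 3), (2, 2), (3, 1)], _ = _))

theorem Segment.IsQuarterPoint.gridPoint_mem_carrier [NeZero N] {P : Segment} {q : ℤ × ℤ}
    (h : IsQuarterPoint N P q) : gridPoint N q ∈ carrier N P := by
  simp only [IsQuarterPoint, List.mem_cons, List.not_mem_nil, or_false, exists_eq_or_imp,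
    exists_eq_left] at h
  obtain h | h | h := h
  exacts [Segment.gridPoint_mem_carrier 1 3 h, Segment.gridPoint_mem_carrier 2 2 h,
    Segment.gridPoint_mem_carrier 3 1 h]

namespace GridDrawing

variable {V : Type*} {G : SimpleGraph V}

/-- The polygonal line from `p` through the points of `l` to `q` is simple, apart from the ends, and
avoids the drawing. -/
def IsRoute (D : GridDrawing G N) (p : ℤ × ℤ) (l : List (ℤ × ℤ)) (q : ℤ × ℤ) : Prop :=
  (p :: l ++ [q]).IsChain (fun a b => IsShort N (a, b)) ∧ (polyline p l q).Pairwise (Apart N) ∧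
    ∀ P ∈ polyline p l q,
      (∀ v, Apart N P (D.point v, D.point v)) ∧ ∀ f ∈ G.edgeSet, Apart N P (D.segment f)

instance [Fintype V] [DecidableRel G.Adj] [DecidableEq V] (D : GridDrawing G N) (p : ℤ × ℤ)
    (l : List (ℤ × ℤ)) (q : ℤ × ℤ) : Decidable (D.IsRoute p l q) :=
  inferInstanceAs (Decidable (_ ∧ _ ∧ _))

variable [NeZero N] {D : GridDrawing G N} {f g : Sym2 V} {p q : ℤ × ℤ} {l : List (ℤ × ℤ)}

theorem IsRoute.isOpenArc (h : D.IsRoute p l q) :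
    IsOpenArc (region N (polyline p l q)) s(gridPoint N p, gridPoint N q) :=
  isOpenArc_region_polyline h.1 h.2.1

theorem IsRoute.region_subset_complement (h : D.IsRoute p l q) :
    region N (polyline p l q) ⊆ D.toDrawing.complement ∅ :=
  D.region_subset_complement (fun P hP => (h.2.2 P hP).1) fun P hP => (h.2.2 P hP).2

theorem hasChord_of_isRoute (hp : IsQuarterPoint N (D.segment f) p)
    (hq : IsQuarterPoint N (D.segment g) q) (hpq : Apart N (p, p) (q, q))
    (h : D.IsRoute p l q) : D.toDrawing.HasChord f g :=
  have hne : gridPoint N p ≠ gridPoint N q := by simpa [carrier_self] using hpq.disjoint_carrier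
  ⟨_, hp.gridPoint_mem_carrier, _, hq.gridPoint_mem_carrier, hne, _, h.region_subset_complement,
    h.isOpenArc⟩

theorem hasLollipop_of_isRoute {v : ℤ × ℤ} (hp : IsQuarterPoint N (D.segment f) p)
    (h : D.IsRoute p (v :: l) v) : D.toDrawing.HasLollipop f := by
  have hcompl := h.region_subset_complement
  obtain ⟨hshort, hapart, -⟩ := h
  obtain ⟨hpv, hshort⟩ := List.isChain_cons_cons.1 hshort
  simp only [polyline, List.pairwise_cons, List.forall_mem_cons] at hapart
  obtain ⟨⟨hTv, hTL⟩, hvL, hapart⟩ := hapart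
  rw [polyline, region_cons, region_cons, carrier_self, union_subset_iff, union_subset_iff,
    singleton_subset_iff] at hcompl
  have hdisj : ∀ {P}, (∀ Q ∈ polyline v l v, Apart N P Q) →
      Disjoint (P.carrier N) (region N (polyline v l v)) := fun {P} hP => by
    simpa [region] using disjoint_region (L := [P]) (by simpa using hP)
  refine ⟨_, hp.gridPoint_mem_carrier, _, _, _, hpv.isOpenArc_carrier,
    isOpenArc_region_polyline hshort hapart, ?_, ?_⟩
  · rw [← carrier_self]
    simpa using ⟨⟨hTv.disjoint_carrier.symm, hdisj hvL⟩, hdisj hTL⟩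
  · simpa using ⟨hcompl.2.1, hcompl.1, hcompl.2.2⟩

end GridDrawing

end Torus

/-! ### A drawing of `F₁₃` -/

section F13Drawing

open GridDrawing Segment

/-- The segments that represent the edges of `F₁₃`, in units of `1 / 20`. -/
def f13Segments : List (Sym2 F13Vertex × Segment) :=
  [(s(r 1, r 2), (14, 10), (16, 8)), (s(r 2, r 3), (16, 8), (12, 4)),
    (s(r 3, r 4), (12, 4), (10, 6)), (s(r 4, r 5), (10, 6), (6, 4)),
    (s(r 5, r 6), (6, 24), (8, 18)), (s(r 6, r 7), (8, 18), (6, 14)),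
    (s(r 7, r 8), (6, 14), (2, 12)), (s(r 8, r 9), (22, 12), (16, 14)),
    (s(r 9, r 1), (16, 14), (14, 10)), (s(A, r 1), (10, 10), (14, 10)),
    (s(A, r 4), (10, 10), (10, 6)), (s(A, r 7), (10, 10), (6, 14)),
    (s(B, r 2), (22, 8), (16, 8)), (s(B, r 5), (2, 8), (6, 4)), (s(B, r 8), (2, 8), (2, 12)),
    (s(C, r 3), (12, 18), (12, 24)), (s(C, r 6), (12, 18), (8, 18)),
    (s(C, r 9), (12, 18), (16, 14))]

theorem mem_edgeSet_F13 {f : Sym2 F13Vertex} : f ∈ F13.edgeSet ↔ f ∈ f13Edges := by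
  induction f with | _ x y => exact Iff.rfl

/-- A drawing of `F₁₃` on the torus. -/
def f13Drawing : GridDrawing F13 20 where
  point := Sum.elim ![(10, 10), (2, 8), (12, 18)]
    ![(16, 14), (14, 10), (16, 8), (12, 4), (10, 6), (6, 4), (8, 18), (6, 14), (2, 12)]
  segment f := (f13Segments.lookup f).getD 0
  ends := by simp only [mem_edgeSet_F13]; decide +kernel
  isShort := by simp only [mem_edgeSet_F13]; decide +kernel
  apart_point_point := by unfold Pairwise; decide +kernel
  apart_point_segment := by simp only [mem_edgeSet_F13]; decide +kernel
  apart_segment_segment := by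
    simp only [Set.Pairwise, mem_edgeSet_F13]
    decide +kernel

/-- Representatives of the orbits of pairs of edges of `F₁₃`, each with the corners of a polygonal
line that joins the two edges. -/
def f13Chords : List ((Sym2 F13Vertex × Sym2 F13Vertex) × (ℤ × ℤ) × List (ℤ × ℤ) × (ℤ × ℤ)) :=
  [((s(r 2, r 3), s(r 2, r 3)), (13, 5), [(14, 5)], (15, 7)),
    ((s(A, r 1), s(A, r 1)), (11, 10), [(12, 9)], (13, 10)),
    ((s(r 4, r 5), s(r 5, r 6)), (8, 5), [], (7, 1)),
    ((s(r 1, r 2), s(r 3, r 4)), (15, 9), [], (11, 5)),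
    ((s(r 4, r 5), s(r 7, r 8)), (8, 5), [], (4, 13)),
    ((s(r 2, r 3), s(r 6, r 7)), (14, 26), [], (27, 16)),
    ((s(r 6, r 7), s(A, r 7)), (7, 16), [], (8, 12)),
    ((s(r 8, r 9), s(B, r 2)), (19, 13), [], (19, 8)),
    ((s(r 7, r 8), s(A, r 4)), (4, 13), [], (10, 8)),
    ((s(r 2, r 3), s(A, r 1)), (14, 6), [], (12, 10)),
    ((s(r 7, r 8), s(C, r 3)), (24, 13), [], (12, 21)),
    ((s(B, r 2), s(B, r 8)), (19, 8), [], (22, 10)),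
    ((s(A, r 7), s(C, r 6)), (8, 12), [], (10, 18)),
    ((s(A, r 1), s(C, r 6)), (12, 10), [], (10, 18)),
    ((s(A, r 7), s(B, r 5)), (8, 12), [], (4, 6))]

theorem hasChord_of_mem_f13Chords {f g : Sym2 F13Vertex} {p q : ℤ × ℤ} {l : List (ℤ × ℤ)}
    (h : ((f, g), p, l, q) ∈ f13Chords) : f13Drawing.toDrawing.HasChord f g :=
  have hroute : ∀ c ∈ f13Chords,
      IsQuarterPoint 20 (f13Drawing.segment c.1.1) c.2.1 ∧
        IsQuarterPoint 20 (f13Drawing.segment c.1.2) c.2.2.2 ∧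
        Apart 20 (c.2.1, c.2.1) (c.2.2.2, c.2.2.2) ∧
        f13Drawing.IsRoute c.2.1 c.2.2.1 c.2.2.2 := by decide +kernel
  have ⟨hp, hq, hpq, hl⟩ := hroute _ h
  hasChord_of_isRoute hp hq hpq hl

theorem hasLollipop_spoke : f13Drawing.toDrawing.HasLollipop s(A, r 1) :=
  hasLollipop_of_isRoute (p := (12, 10)) (v := (12, 9)) (l := [(12, 8), (11, 9)])
    (by decide +kernel) (by decide +kernel)

theorem hasLollipop_rim : f13Drawing.toDrawing.HasLollipop s(r 2, r 3) :=
  hasLollipop_of_isRoute (p := (14, 6)) (v := (14, 5)) (l := [(14, 4), (13, 4)])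
    (by decide +kernel) (by decide +kernel)

/-- The rotation of the nine-cycle by `j`, preceded by the reflection `i ↦ -i` if `b` holds, and its
effect on the vertices `A`, `B`, `C`. -/
def dihedral (b : Bool) (j : Fin 9) : F13Vertex → F13Vertex
  | .inl k => .inl ((if b then 1 - k else k) + Fin.ofNat 3 j)
  | .inr i => .inr ((if b then -i else i) + j)

theorem dihedral_injective : ∀ b j, Injective (dihedral b j) := by decide +kernel

theorem image_dihedral_f13Edges (b : Bool) (j : Fin 9) :
    f13Edges.image (Sym2.map (dihedral b j)) = f13Edges :=
  have hmem : ∀ b j, ∀ f ∈ f13Edges, f.map (dihedral b j) ∈ f13Edges := by decide +kernel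
  Finset.eq_of_subset_of_card_le (Finset.image_subset_iff.2 (hmem b j))
    (Finset.card_image_of_injective _ (Sym2.map.injective (dihedral_injective b j))).ge

/-- The elements of the dihedral group of order eighteen, as automorphisms of `F₁₃`. -/
noncomputable def dihedralIso (b : Bool) (j : Fin 9) : F13 ≃g F13 where
  toEquiv := Equiv.ofBijective _ (Finite.injective_iff_bijective.1 (dihedral_injective b j))
  map_rel_iff' {x y} := by
    have hinj := Sym2.map.injective (dihedral_injective b j)
    rw [← F13.mem_edgeSet, ← F13.mem_edgeSet, mem_edgeSet_F13, mem_edgeSet_F13,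
      ← hinj.mem_finset_image (a := s(x, y)), image_dihedral_f13Edges]
    rfl

theorem exists_map_dihedralIso_mem {f : Sym2 F13Vertex} (hf : f ∈ F13.edgeSet) :
    ∃ b j, f.map (dihedralIso b j) ∈ [s(A, r 1), s(r 2, r 3)] :=
  have horbit : ∀ f ∈ f13Edges, ∃ b j, f.map (dihedral b j) ∈ [s(A, r 1), s(r 2, r 3)] := by
    decide +kernel
  horbit f (mem_edgeSet_F13.1 hf)

theorem exists_iso_hasLollipop {f : Sym2 F13Vertex} (hf : f ∈ F13.edgeSet) :
    ∃ σ : F13 ≃g F13, f13Drawing.toDrawing.HasLollipop (f.map σ) := by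
  obtain ⟨b, j, h⟩ := exists_map_dihedralIso_mem hf
  refine ⟨dihedralIso b j, ?_⟩
  simp only [List.mem_cons, List.not_mem_nil, or_false] at h
  obtain h | h := h <;> rw [h]
  exacts [hasLollipop_spoke, hasLollipop_rim]

theorem exists_mem_f13Chords : ∀ f ∈ [s(A, r 1), s(r 2, r 3)], ∀ g ∈ f13Edges, ∃ b j,
    ∃ c ∈ f13Chords, s(f.map (dihedral b j), g.map (dihedral b j)) = s(c.1.1, c.1.2) := by
  decide +kernel

theorem exists_iso_hasChord {f g : Sym2 F13Vertex} (hf : f ∈ F13.edgeSet) (hg : g ∈ F13.edgeSet) :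
    ∃ σ : F13 ≃g F13, f13Drawing.toDrawing.HasChord (f.map σ) (g.map σ) := by
  obtain ⟨b, j, hf⟩ := exists_map_dihedralIso_mem hf
  obtain ⟨b', j', c, hc, h⟩ := exists_mem_f13Chords _ hf (g.map (dihedralIso b j))
    (mem_edgeSet_F13.1 ((dihedralIso b j).map_mem_edgeSet_iff.2 hg))
  refine ⟨(dihedralIso b j).trans (dihedralIso b' j'), ?_⟩
  have htrans : ⇑((dihedralIso b j).trans (dihedralIso b' j')) =
    dihedral b' j' ∘ dihedralIso b j := rfl
  rw [htrans, ← Sym2.map_map, ← Sym2.map_map]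
  obtain ⟨h₁, h₂⟩ | ⟨h₁, h₂⟩ := Sym2.eq_iff.1 h <;> rw [h₁, h₂]
  · exact hasChord_of_mem_f13Chords hc
  · exact (hasChord_of_mem_f13Chords hc).symm

theorem toroidal_addEdge_F13 (e : EdgeChoice F13) : Toroidal (addEdge F13 e) := by
  cases e with
  | pendant x y h =>
    obtain ⟨σ, hσ⟩ := exists_iso_hasLollipop (F13.mem_edgeSet.2 h)
    exact (f13Drawing.toDrawing.comap σ).nonempty_embedding_addEdge_pendant h hσ.comap
  | same x y h =>
    obtain ⟨σ, hσ⟩ := exists_iso_hasChord (F13.mem_edgeSet.2 h) (F13.mem_edgeSet.2 h)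
    exact (f13Drawing.toDrawing.comap σ).nonempty_embedding_addEdge_same h hσ.comap
  | across x₁ y₁ x₂ y₂ h₁ h₂ hne =>
    obtain ⟨σ, hσ⟩ := exists_iso_hasChord (F13.mem_edgeSet.2 h₁) (F13.mem_edgeSet.2 h₂)
    exact (f13Drawing.toDrawing.comap σ).nonempty_embedding_addEdge_across h₁ h₂ hne hσ.comap

end F13Drawing

/-! ### Girth of `G ∪ e` -/

section Girth

variable {α β : Type*} {H : Graph α β}

theorem girth_le_of_hasCycle {n : ℕ} (h : HasCycle H n) : girth H ≤ n :=
  iInf_le (fun m : {m : ℕ // HasCycle H m} => ((m : ℕ) : ℕ∞)) ⟨n, h⟩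

theorem four_le_girth_of_simple [H.Simple]
    (htriangle : ∀ x y z, H.Adj x y → H.Adj y z → ¬H.Adj z x) : 4 ≤ girth H := by
  refine le_iInf fun ⟨n, hn, v, c, _, hc, hlink⟩ => Nat.ofNat_le_cast.2 ?_
  by_contra! hlt
  interval_cases n
  · exact (hlink 0).ne (congrArg v (Subsingleton.elim _ _))
  · have h₁ : H.IsLink (c 1) (v 1) (v 0) := hlink 1
    exact zero_ne_one (hc ((hlink 0).eq h₁.symm))
  · have h₂ : H.IsLink (c 2) (v 2) (v 0) := hlink 2
    exact htriangle _ _ _ (hlink 0).adj (hlink 1).adj h₂.adj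

theorem hasCycle_three_of_adj {x y z : α} (hxy : H.Adj x y) (hyz : H.Adj y z) (hzx : H.Adj z x)
    (hne : x ≠ y ∧ y ≠ z ∧ z ≠ x) : HasCycle H 3 := by
  obtain ⟨⟨c₀, h₀⟩, ⟨c₁, h₁⟩, ⟨c₂, h₂⟩⟩ := And.intro hxy (And.intro hyz hzx)
  refine ⟨three_pos, ![x, y, z], ![c₀, c₁, c₂], ?_, ?_, Fin.forall_fin_succ.2
    ⟨h₀, Fin.forall_fin_two.2 ⟨h₁, h₂⟩⟩⟩
  · change Injective (_ : Fin 3 → _)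
    simp [Injective, Fin.forall_fin_succ, hne, hne.1.symm, hne.2.1.symm, hne.2.2.symm]
  · have hedge : c₀ ≠ c₁ ∧ c₁ ≠ c₂ ∧ c₂ ≠ c₀ := by
      refine ⟨?_, ?_, ?_⟩ <;> rintro rfl
      · exact (h₀.left_eq_or_eq h₁).elim hne.1 hne.2.2.symm
      · exact (h₁.left_eq_or_eq h₂).elim hne.2.1 hne.1.symm
      · exact (h₂.left_eq_or_eq h₀).elim hne.2.2 hne.2.1.symm
    change Injective (_ : Fin 3 → _)
    simp [Injective, Fin.forall_fin_succ, hedge, hedge.1.symm, hedge.2.1.symm, hedge.2.2.symm]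

end Girth

section AddEdge

variable {V : Type*} {G : SimpleGraph V}

theorem hasCycle_addEdge_pendant {x y : V} (h : G.Adj x y) :
    HasCycle (addEdge G (.pendant x y h)) 1 :=
  ⟨one_pos, fun _ => .inr 1, fun _ => .inr 3, injective_of_subsingleton _,
    injective_of_subsingleton _, fun _ => rfl⟩

theorem hasCycle_addEdge_same {x y : V} (h : G.Adj x y) :
    HasCycle (addEdge G (.same x y h)) 2 := by
  refine ⟨two_pos, ![.inr 0, .inr 1], ![.inr 1, .inr 3], ?_, ?_, Fin.forall_fin_two.2
    ⟨rfl, congrArg some Sym2.eq_swap⟩⟩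
  · change Injective (_ : Fin 2 → _)
    simp [Injective, Fin.forall_fin_two]
  · change Injective (_ : Fin 2 → _)
    simp [Injective, Fin.forall_fin_two]

theorem adj_addEdge {e : EdgeChoice G} {a b : V ⊕ Fin 2} : (addEdge G e).Adj a b ↔
    (∃ f ∈ G.edgeSet, f ∉ e.attached ∧ f.map .inl = s(a, b)) ∨ s(a, b) ∈ e.newEdges := by
  rw [List.mem_iff_getElem?]
  exact Sum.exists

theorem inl_inl_notMem_newEdges (e : EdgeChoice G) (x y : V) :
    s(.inl x, .inl y) ∉ e.newEdges := by
  cases e <;> simp [EdgeChoice.newEdges]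

theorem adj_addEdge_inl_inl {e : EdgeChoice G} {x y : V} :
    (addEdge G e).Adj (.inl x) (.inl y) ↔ G.Adj x y ∧ s(x, y) ∉ e.attached := by
  rw [adj_addEdge, or_iff_left (inl_inl_notMem_newEdges e x y)]
  simp only [← Sym2.map_mk, (Sym2.map.injective Sum.inl_injective).eq_iff, exists_eq_right_right,
    G.mem_edgeSet]

theorem simple_addEdge {e : EdgeChoice G} (hdiag : ∀ f ∈ e.newEdges, ¬f.IsDiag)
    (hnodup : e.newEdges.Nodup) : (addEdge G e).Simple where
  not_isLoopAt c a h := by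
    obtain ⟨f, hf, -, hmap⟩ | h := adj_addEdge.1 ⟨c, h⟩
    · exact G.not_isDiag_of_mem_edgeSet hf
        ((Sym2.isDiag_map Sum.inl_injective).1 (hmap ▸ Sym2.mk_isDiag_iff.2 rfl))
    · exact hdiag _ h rfl
  eq_of_isLink := by
    rintro (f | i) (g | j) a b h h'
    · exact congrArg Sum.inl (Sym2.map.injective Sum.inl_injective (h.2.2.trans h'.2.2.symm))
    · induction f with | _ x y => ?_
      exact (inl_inl_notMem_newEdges e x y
        (List.mem_of_getElem? (h'.trans (congrArg some h.2.2.symm)))).elim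
    · induction g with | _ x y => ?_
      exact (inl_inl_notMem_newEdges e x y
        (List.mem_of_getElem? (h.trans (congrArg some h'.2.2.symm)))).elim
    · exact congrArg Sum.inr ((List.getElem?_inj (List.getElem?_eq_some_iff.1 h).1 hnodup).1
        (Eq.trans h (Eq.symm h')))

variable {x₁ y₁ x₂ y₂ : V} {h₁ : G.Adj x₁ y₁} {h₂ : G.Adj x₂ y₂} {hne : s(x₁, y₁) ≠ s(x₂, y₂)}

theorem adj_addEdge_across_inl_inr {x : V} {i : Fin 2} :
    (addEdge G (.across x₁ y₁ x₂ y₂ h₁ h₂ hne)).Adj (.inl x) (.inr i) ↔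
      x ∈ ![s(x₁, y₁), s(x₂, y₂)] i := by
  have hmap (f : Sym2 V) : f.map Sum.inl ≠ s(.inl x, .inr i) := fun h => by
    simpa [← h] using Sym2.mem_mk_right (Sum.inl x : V ⊕ Fin 2) (.inr i)
  simp only [adj_addEdge, hmap, and_false, exists_false, false_or]
  fin_cases i <;> simp [EdgeChoice.newEdges]

theorem hasCycle_addEdge_across {z : V} (hz₁ : z ∈ s(x₁, y₁)) (hz₂ : z ∈ s(x₂, y₂)) :
    HasCycle (addEdge G (.across x₁ y₁ x₂ y₂ h₁ h₂ hne)) 3 :=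
  hasCycle_three_of_adj (x := .inl z) (y := .inr 0) (z := .inr 1)
    (adj_addEdge_across_inl_inr.2 hz₁) ⟨.inr 4, rfl⟩ (adj_addEdge_across_inl_inr.2 hz₂).symm
    (by simp)

theorem simple_addEdge_across : (addEdge G (.across x₁ y₁ x₂ y₂ h₁ h₂ hne)).Simple :=
  simple_addEdge (by simp [EdgeChoice.newEdges]) (by simp [EdgeChoice.newEdges, h₁.ne, h₂.ne])

theorem not_adj_inl_inr_addEdge_across {x y : V} {i : Fin 2}
    (hxy : (addEdge G (.across x₁ y₁ x₂ y₂ h₁ h₂ hne)).Adj (.inl x) (.inl y))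
    (hx : (addEdge G (.across x₁ y₁ x₂ y₂ h₁ h₂ hne)).Adj (.inl x) (.inr i)) :
    ¬(addEdge G (.across x₁ y₁ x₂ y₂ h₁ h₂ hne)).Adj (.inl y) (.inr i) := by
  intro hy
  rw [adj_addEdge_across_inl_inr] at hx hy
  obtain ⟨hadj, hatt⟩ := adj_addEdge_inl_inl.1 hxy
  refine hatt ?_
  rw [← (Sym2.mem_and_mem_iff hadj.ne).1 ⟨hx, hy⟩]
  fin_cases i
  exacts [.inl rfl, .inr rfl]

theorem eq_of_adj_inl_inr_addEdge_across (hdisj : ∀ z ∈ s(x₁, y₁), z ∉ s(x₂, y₂)) {x : V}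
    {i j : Fin 2} (hi : (addEdge G (.across x₁ y₁ x₂ y₂ h₁ h₂ hne)).Adj (.inl x) (.inr i))
    (hj : (addEdge G (.across x₁ y₁ x₂ y₂ h₁ h₂ hne)).Adj (.inl x) (.inr j)) : i = j := by
  rw [adj_addEdge_across_inl_inr] at hi hj
  fin_cases i <;> fin_cases j
  exacts [rfl, (hdisj x hi hj).elim, (hdisj x hj hi).elim, rfl]

theorem not_adj_addEdge_across (hG : G.CliqueFree 3) (hdisj : ∀ z ∈ s(x₁, y₁), z ∉ s(x₂, y₂))
    {a b c : V ⊕ Fin 2} (hab : (addEdge G (.across x₁ y₁ x₂ y₂ h₁ h₂ hne)).Adj a b)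
    (hbc : (addEdge G (.across x₁ y₁ x₂ y₂ h₁ h₂ hne)).Adj b c) :
    ¬(addEdge G (.across x₁ y₁ x₂ y₂ h₁ h₂ hne)).Adj c a := by
  classical
  intro hca
  have := simple_addEdge_across (h₁ := h₁) (h₂ := h₂) (hne := hne)
  rcases a with a | i <;> rcases b with b | j <;> rcases c with c | k
  · exact hG {a, b, c} (SimpleGraph.is3Clique_triple_iff.2 ⟨(adj_addEdge_inl_inl.1 hab).1,
      (adj_addEdge_inl_inl.1 hca).1.symm, (adj_addEdge_inl_inl.1 hbc).1⟩)
  · exact not_adj_inl_inr_addEdge_across hab hca.symm hbc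
  · exact not_adj_inl_inr_addEdge_across hca hbc.symm hab
  · exact hbc.ne (congrArg _ (eq_of_adj_inl_inr_addEdge_across hdisj hab hca.symm))
  · exact not_adj_inl_inr_addEdge_across hbc hab.symm hca
  · exact hca.ne (congrArg _ (eq_of_adj_inl_inr_addEdge_across hdisj hbc hab.symm))
  · exact hab.ne (congrArg _ (eq_of_adj_inl_inr_addEdge_across hdisj hca hbc.symm))
  · have hij := hab.ne
    have hjk := hbc.ne
    have hki := hca.ne
    simp only [ne_eq, Sum.inr.injEq] at hij hjk hki
    omega

theorem four_le_girth_addEdge_across (hG : G.CliqueFree 3)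
    (hdisj : ∀ z ∈ s(x₁, y₁), z ∉ s(x₂, y₂)) :
    4 ≤ girth (addEdge G (.across x₁ y₁ x₂ y₂ h₁ h₂ hne)) :=
  have := simple_addEdge_across (h₁ := h₁) (h₂ := h₂) (hne := hne)
  four_le_girth_of_simple fun _ _ _ => not_adj_addEdge_across hG hdisj

theorem exists_eq_across_of_four_le_girth {e : EdgeChoice G} (he : 4 ≤ girth (addEdge G e)) :
    ∃ x₁ y₁ x₂ y₂ h₁ h₂ hne, e = .across x₁ y₁ x₂ y₂ h₁ h₂ hne ∧
      ∀ z ∈ s(x₁, y₁), z ∉ s(x₂, y₂) := by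
  have hshort {n : ℕ} (hn : n < 4) (h : HasCycle (addEdge G e) n) : False :=
    hn.not_ge (Nat.ofNat_le_cast.1 (he.trans (girth_le_of_hasCycle h)))
  cases e with
  | pendant x y h => exact (hshort (by simp) (hasCycle_addEdge_pendant h)).elim
  | same x y h => exact (hshort (by simp) (hasCycle_addEdge_same h)).elim
  | across x₁ y₁ x₂ y₂ h₁ h₂ hne =>
    exact ⟨x₁, y₁, x₂, y₂, h₁, h₂, hne, rfl, fun z hz₁ hz₂ =>
      hshort (by simp) (hasCycle_addEdge_across hz₁ hz₂)⟩

end AddEdge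

/-! ### Orbits of pairs of edges -/

section WalkCount

variable {V W : Type*}

/-- The operator on functions on the vertices that is given by the adjacency matrix of `G`. -/
def neighborSum (G : SimpleGraph V) [G.LocallyFinite] (w : V → ℕ) (x : V) : ℕ :=
  ∑ y ∈ G.neighborFinset x, w y

/-- The number of walks of length `n` that start at `x` and end at an end of an edge in `E`. -/
def walkCount (G : SimpleGraph V) [G.LocallyFinite] [DecidableEq V] (E : Finset (Sym2 V)) (n : ℕ) :
    V → ℕ :=
  (neighborSum G)^[n] fun x => if ∃ f ∈ E, x ∈ f then 1 else 0

variable {G : SimpleGraph V} {G' : SimpleGraph W} [G.LocallyFinite] [G'.LocallyFinite]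

theorem neighborSum_comp (σ : G ≃g G') (w : W → ℕ) :
    neighborSum G (w ∘ σ) = neighborSum G' w ∘ σ :=
  funext fun x => Finset.sum_equiv σ.toEquiv (by simp [← σ.map_adj_iff]) fun _ _ => rfl

theorem walkCount_image [DecidableEq V] [DecidableEq W] (σ : G ≃g G') (E : Finset (Sym2 V))
    (n : ℕ) (x : V) :
    walkCount G' (E.image (Sym2.map σ)) n (σ x) = walkCount G E n x := by
  have hcomp := ((show Semiconj (· ∘ σ) (neighborSum G') (neighborSum G) from
    fun w => (neighborSum_comp σ w).symm).iterate_right n).eq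
  refine (congrFun (hcomp _) x).trans ?_
  simp [walkCount, comp_def, Sym2.mem_map, σ.injective.eq_iff]

theorem sum_walkCount_image_pow [Fintype V] [Fintype W] [DecidableEq V] [DecidableEq W]
    (σ : G ≃g G') (E : Finset (Sym2 V)) (n m : ℕ) :
    ∑ x, walkCount G' (E.image (Sym2.map σ)) n x ^ m = ∑ x, walkCount G E n x ^ m := by
  simp only [← walkCount_image σ E]
  exact (Equiv.sum_comp σ.toEquiv fun x => walkCount G' (E.image (Sym2.map σ)) n x ^ m).symm

end WalkCount

section Orbits

/-- The pairs of edges to which the ten choices are attached, as finite sets for use in `decide`. -/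
def tenEdges : Fin 10 → Finset (Sym2 F13Vertex) :=
  ![{s(A, r 1), s(B, r 2)}, {s(A, r 1), s(C, r 3)}, {s(A, r 1), s(B, r 5)},
    {s(A, r 1), s(r 2, r 3)}, {s(A, r 1), s(r 3, r 4)}, {s(A, r 1), s(r 4, r 5)},
    {s(A, r 1), s(r 5, r 6)}, {s(r 1, r 2), s(r 3, r 4)}, {s(r 1, r 2), s(r 4, r 5)},
    {s(r 1, r 2), s(r 5, r 6)}]

theorem coe_tenEdges (k : Fin 10) :
    (tenEdges k : Set (Sym2 F13Vertex)) = (tenCases k).attached := by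
  fin_cases k <;> exact Finset.coe_pair

theorem cliqueFree_F13 : F13.CliqueFree 3 := by
  have htriangle : ∀ x y, F13.Adj x y → ∀ z, F13.Adj x z → ¬F13.Adj y z := by decide +kernel
  intro t ht
  obtain ⟨x, y, z, hxy, hxz, hyz, -⟩ := SimpleGraph.is3Clique_iff.1 ht
  exact htriangle x y hxy z hxz hyz

theorem four_le_girth_tenCases (k : Fin 10) : 4 ≤ girth (addEdge F13 (tenCases k)) := by
  fin_cases k <;> exact four_le_girth_addEdge_across cliqueFree_F13 (by decide)

theorem exists_tenEdges : ∀ f ∈ [s(A, r 1), s(r 2, r 3)], ∀ g ∈ f13Edges, (∀ z ∈ f, z ∉ g) →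
    ∃ k b j, {f.map (dihedral b j), g.map (dihedral b j)} = tenEdges k := by
  decide +kernel

theorem exists_tenCases {e : EdgeChoice F13} (he : 4 ≤ girth (addEdge F13 e)) :
    ∃ k, ∃ σ : F13 ≃g F13, Sym2.map σ '' e.attached = (tenCases k).attached := by
  obtain ⟨x₁, y₁, x₂, y₂, h₁, h₂, hne, rfl, hdisj⟩ := exists_eq_across_of_four_le_girth he
  obtain ⟨b, j, hmem⟩ := exists_map_dihedralIso_mem (F13.mem_edgeSet.2 h₁)
  have hdisj' : ∀ z ∈ s(x₁, y₁).map (dihedralIso b j), z ∉ s(x₂, y₂).map (dihedralIso b j) := by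
    intro z hz hz'
    obtain ⟨x, hx, rfl⟩ := Sym2.mem_map.1 hz
    obtain ⟨y, hy, hyx⟩ := Sym2.mem_map.1 hz'
    exact hdisj x hx ((dihedralIso b j).injective hyx ▸ hy)
  obtain ⟨k, b', j', hk⟩ := exists_tenEdges _ hmem _
    (mem_edgeSet_F13.1 ((dihedralIso b j).map_mem_edgeSet_iff.2 h₂)) hdisj'
  refine ⟨k, (dihedralIso b j).trans (dihedralIso b' j'), ?_⟩
  rw [← coe_tenEdges, ← hk, Finset.coe_pair, Sym2.map_map, Sym2.map_map]
  exact image_pair _ _ _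

/-- The neighbours of a vertex of `F₁₃`, in a form that is fast to evaluate. -/
def f13Neighbors : F13Vertex → Finset F13Vertex
  | .inl k => {r (Fin.ofNat 9 (k + 1)), r (Fin.ofNat 9 (k + 4)), r (Fin.ofNat 9 (k + 7))}
  | .inr i => {r (i + 1), r (i - 1), .inl (Fin.ofNat 3 i - 1)}

theorem neighborSum_F13 (w : F13Vertex → ℕ) :
    neighborSum F13 w = fun x => ∑ y ∈ f13Neighbors x, w y := by
  have h : ∀ x, F13.neighborFinset x = f13Neighbors x := by decide +kernel
  exact funext fun x => congrArg (Finset.sum · w) (h x)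

theorem sum_walkCount_tenEdges_pow (k : Fin 10) : ∑ x, walkCount F13 (tenEdges k) 3 x ^ 3 =
    ![9222, 10068, 9582, 10488, 10116, 9576, 10380, 10134, 11406, 9450] k := by
  simp only [walkCount, iterate_succ, iterate_zero, comp_apply, id, neighborSum_F13]
  revert k
  decide +kernel

theorem tenCases_unique {S : Set (Sym2 F13Vertex)} {k l : Fin 10} {σ τ : F13 ≃g F13}
    (hσ : Sym2.map σ '' S = (tenCases k).attached) (hτ : Sym2.map τ '' S = (tenCases l).attached) :
    k = l := by
  have himage : (tenEdges k).image (Sym2.map (σ.symm.trans τ)) = tenEdges l := by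
    rw [← Finset.coe_inj, Finset.coe_image, coe_tenEdges, coe_tenEdges, ← hσ, ← hτ, image_image]
    simp [Sym2.map_map]
  have hinj : Injective ![9222, 10068, 9582, 10488, 10116, 9576, 10380, 10134, 11406, 9450] := by
    decide
  refine hinj ?_
  rw [← sum_walkCount_tenEdges_pow, ← sum_walkCount_tenEdges_pow, ← himage,
    sum_walkCount_image_pow]

end Orbits

end ToroidalGraphs

open ToroidalGraphs in
theorem mainTheorem8 :
    (∀ e : EdgeChoice F13, Toroidal (addEdge F13 e)) ∧
    (∀ k : Fin 10, 4 ≤ girth (addEdge F13 (tenCases k))) ∧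
    (∀ e : EdgeChoice F13, 4 ≤ girth (addEdge F13 e) →
      ∃! k : Fin 10, ∃ σ : F13 ≃g F13, Sym2.map σ '' e.attached = (tenCases k).attached) := by
  refine ⟨toroidal_addEdge_F13, four_le_girth_tenCases, fun e he => ?_⟩
  obtain ⟨k, σ, hσ⟩ := exists_tenCases he
  exact ⟨k, ⟨σ, hσ⟩, fun l ⟨τ, hτ⟩ => tenCases_unique hτ hσ⟩
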